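/- Let $\mathfrak g$ be a finite-dimensional real nilpotent Lie algebra of dimension $n$. A basis $e_1,\dots,e_n$ of $\mathfrak g$, with dual basis $e^1,\dots,e^n$, is called nice if for all $i,j$ the bracket $[e_i,e_j]$ is a (possibly zero) real multiple of a single basis element $e_k$ depending on $i,j$, and for all $i,j$ the interior product $e_i\lrcorner de^j$ is a (possibly zero) real multiple of a single $e^h$ depending on $i,j$; here $d\alpha(x,y)=-\alpha([x,y])$ for $\alpha\in\mathfrak g^*$. Two nice bases of $\mathfrak g$ are called equivalent if there is a Lie algebra automorphism of $\mathfrak g$ mapping each element of the first basis to a multiple of an element of the second. Then the set of equivalence classes of nice bases of $\mathfrak g$ is at most countable. -/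

import Mathlib

open Module

noncomputable section

namespace NiceLie

universe u v w x

/-- The exterior derivative of a 1-form on a real Lie algebra,
`(d α)(x, y) = -α([x, y])`, as a curried bilinear form. The interior product
`x ⌟ d α` is therefore `extDeriv α x`. -/
def extDeriv {L : Type u} [LieRing L] [LieAlgebra ℝ L] (α : Dual ℝ L) :
    L →ₗ[ℝ] Dual ℝ L :=
  -((LieModule.toEnd ℝ L L : L →ₗ[ℝ] Module.End ℝ L).compr₂ α)

theorem extDeriv_apply {L : Type u} [LieRing L] [LieAlgebra ℝ L] (α : Dual ℝ L) (x y : L) :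
    extDeriv α x y = -α ⁅x, y⁆ := by
  simp [extDeriv]

/-- A basis `e` of a real Lie algebra, with dual basis `e^j = e.coord j`, is nice if each
`[e_i, e_j]` is a multiple of a single `e_k` and each `e_i ⌟ d e^j` is a multiple of a
single `e^h`. -/
def IsNice {L : Type u} [LieRing L] [LieAlgebra ℝ L] {ι : Type v} (e : Basis ι ℝ L) : Prop :=
  (∀ i j, ∃ k, ∃ c : ℝ, ⁅e i, e j⁆ = c • e k) ∧
  (∀ i j, ∃ h, ∃ c : ℝ, extDeriv (e.coord j) (e i) = c • e.coord h)

/-- The Lie algebras with fixed bases `(L, e)` and `(L', e')` are equivalent if there is an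
isomorphism of Lie algebras mapping basis elements to multiples of basis elements. -/
def Equivalent {L : Type u} [LieRing L] [LieAlgebra ℝ L] {ι : Type v}
    {L' : Type w} [LieRing L'] [LieAlgebra ℝ L'] {ι' : Type x}
    (e : Basis ι ℝ L) (e' : Basis ι' ℝ L') : Prop :=
  ∃ φ : L ≃ₗ⁅ℝ⁆ L', ∀ i, ∃ j, ∃ c : ℝ, φ (e i) = c • e' j

theorem Equivalent.refl {L : Type u} [LieRing L] [LieAlgebra ℝ L] {ι : Type v}
    (e : Basis ι ℝ L) : Equivalent e e :=
  ⟨LieEquiv.refl, fun i => ⟨i, 1, by simp⟩⟩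

theorem Equivalent.trans {L : Type u} [LieRing L] [LieAlgebra ℝ L] {ι : Type v}
    {e₁ e₂ e₃ : Basis ι ℝ L} (h : Equivalent e₁ e₂) (h' : Equivalent e₂ e₃) :
    Equivalent e₁ e₃ := by
  obtain ⟨φ, hφ⟩ := h
  obtain ⟨ψ, hψ⟩ := h'
  refine ⟨φ.trans ψ, fun i => ?_⟩
  obtain ⟨j, c, hj⟩ := hφ i
  obtain ⟨k, d, hk⟩ := hψ j
  exact ⟨k, c * d, by simp [LieEquiv.trans_apply, hj, hk, mul_smul]⟩

theorem Equivalent.symm {L : Type u} [LieRing L] [LieAlgebra ℝ L] {ι : Type v} [Finite ι]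
    {e e' : Basis ι ℝ L} (h : Equivalent e e') : Equivalent e' e := by
  obtain ⟨φ, hφ⟩ := h
  choose σ c hσ using hφ
  have hl : ∀ i, φ.toLinearEquiv (e i) = c i • e' (σ i) := hσ
  have hc : ∀ i, c i ≠ 0 := by
    intro i hi
    have h0 : φ (e i) = 0 := by rw [hσ i, hi, zero_smul]
    exact e.ne_zero i (φ.toLinearEquiv.map_eq_zero_iff.1 h0)
  have hinj : Function.Injective σ := by
    intro i k hik
    have h0 : c k • e i = c i • e k := by
      apply φ.toLinearEquiv.injective
      rw [map_smul, map_smul, hl i, hl k, hik, smul_comm]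
    by_contra hne
    have h1 := congrArg (fun v => e.repr v i) h0
    simp [Ne.symm hne] at h1
    exact hc k h1
  have hsurj : Function.Surjective σ := Finite.surjective_of_injective hinj
  refine ⟨φ.symm, fun j => ?_⟩
  obtain ⟨i, rfl⟩ := hsurj j
  refine ⟨i, (c i)⁻¹, ?_⟩
  apply φ.toLinearEquiv.injective
  rw [map_smul, hl i]
  change φ (φ.symm (e' (σ i))) = _
  rw [LieEquiv.apply_symm_apply, smul_smul, inv_mul_cancel₀ (hc i),
    one_smul]

/-- The nice bases `e_1, …, e_n` of a finite-dimensional real Lie algebra of dimension `n`. -/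
def NiceBasis (L : Type u) [LieRing L] [LieAlgebra ℝ L] : Type u :=
  {e : Basis (Fin (finrank ℝ L)) ℝ L // IsNice e}

/-- Equivalence of nice bases on a fixed Lie algebra. -/
def niceBasisSetoid (L : Type u) [LieRing L] [LieAlgebra ℝ L] : Setoid (NiceBasis L) where
  r e e' := Equivalent e.1 e'.1
  iseqv := ⟨fun e => Equivalent.refl e.1, fun h => h.symm, fun h h' => h.trans h'⟩

end NiceLie

end

/-! A nice basis is locally rigid among bases with the same support of structure constants. Let GL
act on products by change of basis; the infinitesimal action of `x` is its Leibniz defect. If this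
defect vanishes wherever the structure constants do, then removing the diagonal of `x` leaves a
derivation: by niceness, off-diagonal entries contribute only off the support
(`NicePattern.mem_sup`).

Choose a complement `M` of derivations + diagonal operators. Near the identity every operator is
`exp(derivation) * (1 + x) * (1 + diagonal)` with `x` in `M`, and preservation of the support forces
`x = 0` by injectivity of a derivative. What remains is an automorphism and a rescaling, so nearby
bases with the same support are equivalent.

Equivalence classes are thus open in a second countable space, namely coordinates together with the
discrete support, and so they are countably many. -/

open Module

noncomputable section

namespace NiceLie

open Filter Topology

/-! ### Derivations, diagonal operators and nice patterns -/

section Algebra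

variable {E : Type*} [NormedAddCommGroup E] [NormedSpace ℝ E]
  {ι : Type*} (b : Basis ι ℝ E) (β : E →L[ℝ] E →L[ℝ] E)

/-- The failure of the Leibniz rule of `x` for the product `β`, on pairs of basis vectors. -/
def leibnizDefect : (E →L[ℝ] E) →ₗ[ℝ] (ι → ι → E) where
  toFun x i j := β (x (b i)) (b j) + β (b i) (x (b j)) - x (β (b i) (b j))
  map_add' x y := by
    ext i j
    simp only [add_apply, map_add, Pi.add_apply]
    abel
  map_smul' c x := by
    ext i j
    simp [smul_sub, smul_add]

theorem leibnizDefect_apply (x : E →L[ℝ] E) (i j : ι) :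
    leibnizDefect b β x i j = β (x (b i)) (b j) + β (b i) (x (b j)) - x (β (b i) (b j)) := rfl

variable {b β} in
theorem leibniz_of_mem_ker {s : E →L[ℝ] E} (hs : s ∈ (leibnizDefect b β).ker) (u v : E) :
    s (β u v) = β (s u) v + β u (s v) := by
  have h : β.toLinearMap₁₂.compr₂ (s : E →ₗ[ℝ] E) =
      β.toLinearMap₁₂.comp (s : E →ₗ[ℝ] E) + β.toLinearMap₁₂.compl₂ (s : E →ₗ[ℝ] E) := by
    refine b.ext fun i => b.ext fun j => ?_
    have := congrFun (congrFun (LinearMap.mem_ker.1 hs) i) j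
    rw [leibnizDefect_apply] at this
    exact (sub_eq_zero.1 this).symm
  exact LinearMap.congr_fun₂ h u v

/-- The exponential of a derivation is multiplicative. -/
theorem exp_apply_bilin [CompleteSpace E] {β : E →L[ℝ] E →L[ℝ] E} {s : E →L[ℝ] E}
    (hs : ∀ u v, s (β u v) = β (s u) v + β u (s v)) (u v : E) :
    NormedSpace.exp s (β u v) = β (NormedSpace.exp s u) (NormedSpace.exp s v) := by
  have hE (w : E) (t : ℝ) : HasDerivAt (fun t : ℝ => NormedSpace.exp (t • s) w)
      (s (NormedSpace.exp (t • s) w)) t := by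
    have := (hasDerivAt_exp_smul_const' s t).clm_apply (hasDerivAt_const t w)
    simpa using this
  -- By the Leibniz rule the product transported along the flow of `s` is constant; the values at
  -- times 1 and 0 are compared below.
  have hd (t : ℝ) : HasDerivAt (fun t : ℝ => NormedSpace.exp (t • -s)
      (β (NormedSpace.exp (t • s) u) (NormedSpace.exp (t • s) v))) 0 t := by
    have h1 := hasDerivAt_exp_smul_const (-s) t
    have h2 := (β.hasFDerivAt.comp_hasDerivAt t (hE u t)).clm_apply (hE v t)
    have h3 := h1.clm_apply h2
    refine h3.congr_deriv ?_
    simp only [Function.comp_apply, mul_apply_eq_comp, neg_apply, ← hs, map_neg]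
    exact neg_add_cancel _
  have hc := is_const_of_deriv_eq_zero (fun t => (hd t).differentiableAt)
    (fun t => (hd t).deriv) 1 0
  simp only [one_smul, zero_smul, NormedSpace.exp_zero, one_apply_eq_self] at hc
  have h1 : NormedSpace.exp s * NormedSpace.exp (-s) = 1 := by
    let _ : NormedAlgebra ℚ (E →L[ℝ] E) := NormedAlgebra.restrictScalars ℚ ℝ _
    rw [← NormedSpace.exp_add_of_commute (Commute.neg_right (Commute.refl s)), add_neg_cancel,
      NormedSpace.exp_zero]
  rw [← hc, ← mul_apply_eq_comp, h1, one_apply_eq_self]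

variable [FiniteDimensional ℝ E]

/-- The operators that are diagonal in the basis `b`. -/
def diag : (ι → ℝ) →ₗ[ℝ] (E →L[ℝ] E) where
  toFun t := LinearMap.toContinuousLinearMap (b.constr ℝ fun i => t i • b i)
  map_add' t t' := by
    ext v
    have : b.constr ℝ (fun i => (t + t') i • b i) =
        b.constr ℝ (fun i => t i • b i) + b.constr ℝ (fun i => t' i • b i) :=
      b.ext fun i => by
        simp only [LinearMap.add_apply, Basis.constr_basis, Pi.add_apply, add_smul]
    exact LinearMap.congr_fun this v
  map_smul' c t := by
    ext v
    have : b.constr ℝ (fun i => (c • t) i • b i) = c • b.constr ℝ (fun i => t i • b i) :=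
      b.ext fun i => by
        simp only [LinearMap.smul_apply, Basis.constr_basis, Pi.smul_apply, smul_eq_mul, mul_smul]
    exact LinearMap.congr_fun this v

@[simp]
theorem diag_apply_basis (t : ι → ℝ) (i : ι) : diag b t (b i) = t i • b i :=
  b.constr_basis ℝ _ i

/-- The structure constants of a product in a basis form a nice pattern: any two of the three
indices of a nonzero structure constant determine the third. -/
structure NicePattern : Prop where
  right_unique : ∀ {i j k l}, b.coord k (β (b i) (b j)) ≠ 0 → b.coord l (β (b i) (b j)) ≠ 0 → k = l
  fst_unique : ∀ {i j k l}, b.coord k (β (b i) (b j)) ≠ 0 → b.coord k (β (b l) (b j)) ≠ 0 → i = l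
  snd_unique : ∀ {i j k l}, b.coord k (β (b i) (b j)) ≠ 0 → b.coord k (β (b i) (b l)) ≠ 0 → j = l

variable {b β}

/-- An operator whose infinitesimal action preserves the support of the structure constants of a
nice pattern is the sum of a derivation and a diagonal operator. -/
theorem NicePattern.mem_sup [Fintype ι] (h : NicePattern b β) {x : E →L[ℝ] E}
    (hx : ∀ i j k, b.coord k (β (b i) (b j)) = 0 → b.coord k (leibnizDefect b β x i j) = 0) :
    x ∈ (leibnizDefect b β).ker ⊔ (diag b).range := by
  classical
  set d : ι → ℝ := fun i => b.coord i (x (b i)) with hd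
  refine Submodule.mem_sup.2 ⟨x - diag b d, ?_, diag b d, ⟨d, rfl⟩, sub_add_cancel _ _⟩
  rw [LinearMap.mem_ker]
  ext i j
  refine b.ext_elem fun k => ?_
  simp only [Pi.zero_apply, map_zero, Finsupp.coe_zero]
  change b.coord k _ = 0
  have expand_fst (u : E) (w : E) : b.coord k (β u w) =
      ∑ a, b.coord a u * b.coord k (β (b a) w) := by
    conv_lhs => rw [← b.sum_repr u]
    simp only [map_sum, map_smul, sum_apply, smul_apply, smul_eq_mul, Basis.coord_apply]
  have expand_snd (u : E) (w : E) : b.coord k (β w u) =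
      ∑ a, b.coord a u * b.coord k (β w (b a)) := by
    conv_lhs => rw [← b.sum_repr u]
    simp only [map_sum, map_smul, smul_eq_mul, Basis.coord_apply]
  have expand_op (y : E →L[ℝ] E) (u : E) : b.coord k (y u) =
      ∑ a, b.coord a u * b.coord k (y (b a)) := by
    conv_lhs => rw [← b.sum_repr u]
    simp only [map_sum, map_smul, smul_eq_mul, Basis.coord_apply]
  -- Off the support, the defects of `x` and of the diagonal part both vanish. On it, every term of
  -- the expansion pairs a structure constant with an entry of `x - diag b d`; niceness leaves only
  -- diagonal entries, which are zero.
  by_cases hk : b.coord k (β (b i) (b j)) = 0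
  · rw [map_sub, Pi.sub_apply, Pi.sub_apply, map_sub, hx i j k hk, zero_sub, neg_eq_zero,
      leibnizDefect_apply, map_sub, map_add, diag_apply_basis, diag_apply_basis,
      expand_op (diag b d), Finset.sum_eq_zero]
    · simp only [map_smul, smul_apply, smul_eq_mul, hk, mul_zero, add_zero, sub_zero]
    · intro a _
      rw [diag_apply_basis, map_smul, smul_eq_mul]
      rcases eq_or_ne a k with rfl | hne
      · rw [hk, zero_mul]
      · simp [hne]
  · have hy (l : ι) : b.coord l ((x - diag b d) (b l)) = 0 := by
      simp [hd]
    rw [leibnizDefect_apply, map_sub, map_add, expand_fst, expand_snd,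
      expand_op (x - diag b d) (β (b i) (b j)), Finset.sum_eq_zero, Finset.sum_eq_zero,
      Finset.sum_eq_zero]
    · simp
    · intro a _
      by_cases ha : b.coord a (β (b i) (b j)) = 0
      · rw [ha, zero_mul]
      · rw [h.right_unique ha hk, hy, mul_zero]
    · intro a _
      by_cases ha : b.coord k (β (b i) (b a)) = 0
      · rw [ha, mul_zero]
      · rw [h.snd_unique ha hk, hy, zero_mul]
    · intro a _
      by_cases ha : b.coord k (β (b a) (b j)) = 0
      · rw [ha, mul_zero]
      · rw [h.fst_unique ha hk, hy, zero_mul]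

end Algebra

/-! ### Local rigidity by differential calculus -/

section Analysis

variable {E : Type*} [NormedAddCommGroup E] [NormedSpace ℝ E] [FiniteDimensional ℝ E]
  {ι : Type*} [Fintype ι] {b : Basis ι ℝ E} {β : E →L[ℝ] E →L[ℝ] E}

/-- Linearises the change-of-basis action at the identity: differentiating the inverse yields the
term `-x (β u v)`, so the derivative is the Leibniz defect. -/
theorem hasFDerivAt_inverse_apply_bilin (u v : E) :
    ∃ F' : (E →L[ℝ] E) →L[ℝ] E,
      HasFDerivAt (fun m : E →L[ℝ] E => Ring.inverse m (β (m u) (m v))) F' 1 ∧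
      ∀ x, F' x = β (x u) v + β u (x v) - x (β u v) := by
  have : CompleteSpace E := FiniteDimensional.complete ℝ E
  have h0 := hasFDerivAt_ringInverse (𝕜 := ℝ) (1 : (E →L[ℝ] E)ˣ)
  have h1 (w : E) : HasFDerivAt (fun m : E →L[ℝ] E => m w) _ (1 : E →L[ℝ] E) :=
    (hasFDerivAt_id (1 : E →L[ℝ] E)).clm_apply (hasFDerivAt_const w _)
  have h2 := h0.clm_apply ((β.hasFDerivAt.comp _ (h1 u)).clm_apply (h1 v))
  refine ⟨_, h2, fun x => ?_⟩
  simp [sub_eq_add_neg]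
  abel

/-- Transversally to the derivations and diagonal operators, a small change of basis does not
preserve the support of the structure constants. -/
theorem NicePattern.eventually_eq_zero (h : NicePattern b β) {V : Type*} [NormedAddCommGroup V]
    [NormedSpace ℝ V] [FiniteDimensional ℝ V] (J : V →L[ℝ] E →L[ℝ] E)
    (hJ : ∀ x, J x ∈ (leibnizDefect b β).ker ⊔ (diag b).range → x = 0) :
    ∀ᶠ x : V in 𝓝 0, (∀ i j k, b.coord k (β (b i) (b j)) = 0 →
      b.coord k (Ring.inverse (1 + J x) (β ((1 + J x) (b i)) ((1 + J x) (b j)))) = 0) → x = 0 := by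
  classical
  choose F' hF hF' using fun i j => hasFDerivAt_inverse_apply_bilin (β := β) (b i) (b j)
  -- Only the vanishing structure constants are tracked: `G` measures how far they move away from
  -- zero.
  let I := {p : ι × ι × ι // b.coord p.2.2 (β (b p.1) (b p.2.1)) = 0}
  let _ : Fintype I := Fintype.ofFinite I
  let c : ι → E →L[ℝ] ℝ := fun k => LinearMap.toContinuousLinearMap (b.coord k)
  let G : V → I → ℝ := fun x p => c p.1.2.2 (Ring.inverse (1 + J x)
    (β ((1 + J x) (b p.1.1)) ((1 + J x) (b p.1.2.1))))
  let G' : V →L[ℝ] I → ℝ := ContinuousLinearMap.pi fun p =>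
    (c p.1.2.2).comp ((F' p.1.1 p.1.2.1).comp J)
  have hG : HasFDerivAt G G' 0 := by
    refine hasFDerivAt_pi''  fun p => ?_
    have h1 : HasFDerivAt (fun x : V => 1 + J x) J 0 := J.hasFDerivAt.const_add 1
    have h2 : HasFDerivAt (fun m : E →L[ℝ] E => Ring.inverse m (β (m (b p.1.1)) (m (b p.1.2.1))))
      (F' p.1.1 p.1.2.1) (1 + J 0) := by simpa using hF p.1.1 p.1.2.1
    have h3 := h2.comp (f := fun x : V => 1 + J x) (0 : V) h1
    exact (c p.1.2.2).hasFDerivAt.comp (0 : V) h3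
  have hker : (G' : V →ₗ[ℝ] I → ℝ).ker = ⊥ := by
    rw [LinearMap.ker_eq_bot']
    intro x hx
    refine hJ x (h.mem_sup fun i j k hk => ?_)
    rw [leibnizDefect_apply, ← hF']
    exact congrFun hx ⟨(i, j, k), hk⟩
  obtain ⟨K, -, hK⟩ := LinearMap.exists_antilipschitzWith (G' : V →ₗ[ℝ] I → ℝ) hker
  -- An injective derivative in finite dimension is bounded below, so `0` is an isolated zero of
  -- `G`.
  have hne := hG.eventually_ne (c := 0) ⟨K, hK⟩
  rw [eventually_nhdsWithin_iff] at hne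
  filter_upwards [hne] with x hx hsupp
  by_contra hx0
  exact hx hx0 (funext fun p => hsupp _ _ _ p.2)

/-- If three linear maps into a Banach algebra are jointly surjective, then every element near the
identity factors through them, with small parameters. -/
theorem eventually_exists_factorization {A V₁ V₂ V₃ : Type*} [NormedRing A] [NormedAlgebra ℝ A]
    [CompleteSpace A] [NormedAddCommGroup V₁] [NormedSpace ℝ V₁] [CompleteSpace V₁]
    [NormedAddCommGroup V₂] [NormedSpace ℝ V₂] [CompleteSpace V₂]
    [NormedAddCommGroup V₃] [NormedSpace ℝ V₃] [CompleteSpace V₃]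
    (J₁ : V₁ →L[ℝ] A) (J₂ : V₂ →L[ℝ] A) (J₃ : V₃ →L[ℝ] A)
    (hJ : ∀ g, ∃ s x t, J₁ s + J₂ x + J₃ t = g) {P : V₂ → Prop} (hP : ∀ᶠ x in 𝓝 0, P x) :
    ∀ᶠ g : A in 𝓝 1, ∃ s x t, P x ∧ g = NormedSpace.exp (J₁ s) * (1 + J₂ x) * (1 + J₃ t) := by
  let p1 : V₁ × V₂ × V₃ →L[ℝ] A := J₁.comp (ContinuousLinearMap.fst ℝ _ _)
  let p2 : V₁ × V₂ × V₃ →L[ℝ] A :=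
    J₂.comp ((ContinuousLinearMap.fst ℝ _ _).comp (ContinuousLinearMap.snd ℝ _ _))
  let p3 : V₁ × V₂ × V₃ →L[ℝ] A :=
    J₃.comp ((ContinuousLinearMap.snd ℝ _ _).comp (ContinuousLinearMap.snd ℝ _ _))
  let Φ : V₁ × V₂ × V₃ → A := fun q => NormedSpace.exp (p1 q) * (1 + p2 q) * (1 + p3 q)
  -- The derivative at the origin is the sum of the three maps; being onto, it makes `Φ` send
  -- neighbourhoods of `0` onto neighbourhoods of `1`.
  have hΦ : HasStrictFDerivAt Φ (p1 + p2 + p3) 0 := by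
    have e0 : HasStrictFDerivAt (NormedSpace.exp : A → A) (1 : A →L[ℝ] A) (p1 0) := by
      rw [map_zero]; exact hasStrictFDerivAt_exp_zero
    have h1 := e0.comp (0 : V₁ × V₂ × V₃) p1.hasStrictFDerivAt
    have h2 : HasStrictFDerivAt (fun q => 1 + p2 q) p2 0 := p2.hasStrictFDerivAt.const_add 1
    have h3 : HasStrictFDerivAt (fun q => 1 + p3 q) p3 0 := p3.hasStrictFDerivAt.const_add 1
    refine ((h1.mul' h2).mul' h3).congr_fderiv ?_
    refine ContinuousLinearMap.ext fun q => ?_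
    simp [add_comm, add_left_comm]
  have hsurj : (p1 + p2 + p3).range = ⊤ := by
    rw [LinearMap.range_eq_top]
    intro g
    obtain ⟨s, x, t, hg⟩ := hJ g
    exact ⟨(s, x, t), hg⟩
  have hmap := hΦ.map_nhds_eq_of_surj hsurj
  have h0 : Φ 0 = 1 := by simp [Φ]
  rw [h0] at hmap
  rw [← hmap]
  have hP' : ∀ᶠ q : V₁ × V₂ × V₃ in 𝓝 0, P q.2.1 :=
    (continuous_fst.comp continuous_snd).continuousAt.eventually hP
  filter_upwards [image_mem_map hP'] with g hg
  obtain ⟨q, hq, rfl⟩ := hg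
  exact ⟨q.1, q.2.1, q.2.2, hq, rfl⟩

theorem exists_continuousLinearMap_range_eq {A : Type*} [NormedAddCommGroup A] [NormedSpace ℝ A]
    (S : Submodule ℝ A) [FiniteDimensional ℝ S] :
    ∃ (k : ℕ) (J : (Fin k → ℝ) →L[ℝ] A), J.range = S ∧ ∀ v, J v = 0 → v = 0 := by
  let ε := (Module.finBasis ℝ S).equivFun.symm
  refine ⟨_, LinearMap.toContinuousLinearMap (S.subtype ∘ₗ ε.toLinearMap), ?_, fun v hv => ?_⟩
  · rw [LinearMap.coe_toContinuousLinearMap, LinearMap.range_comp, LinearEquiv.range,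
      Submodule.map_top, Submodule.range_subtype]
  · exact ε.map_eq_zero_iff.1 (Subtype.ext hv)

/-- Local rigidity: a basis close to one with a nice pattern, whose structure constants have
support contained in that of the given one, is obtained from it by an automorphism and rescaling. -/
theorem NicePattern.eventually_exists_automorphism (h : NicePattern b β) :
    ∀ᶠ g : E →L[ℝ] E in 𝓝 1, ∀ b' : Basis ι ℝ E, (∀ i, b' i = g (b i)) →
      (∀ i j k, b.coord k (β (b i) (b j)) = 0 → b'.coord k (β (b' i) (b' j)) = 0) →
      ∃ φ : E ≃ₗ[ℝ] E, (∀ u v, φ (β u v) = β (φ u) (φ v)) ∧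
        ∀ i, ∃ c : ℝ, φ (b i) = c • b' i := by
  have : CompleteSpace E := FiniteDimensional.complete ℝ E
  obtain ⟨M, hM⟩ := Submodule.exists_isCompl ((leibnizDefect b β).ker ⊔ (diag b).range)
  obtain ⟨_, J₁, hJ₁, -⟩ := exists_continuousLinearMap_range_eq (leibnizDefect b β).ker
  obtain ⟨_, J₂, hJ₂, hJ₂0⟩ := exists_continuousLinearMap_range_eq M
  have hunit : ∀ᶠ x in 𝓝 0, IsUnit (1 + J₂ x) := by
    have hc : Continuous fun x => 1 + J₂ x := continuous_const.add J₂.continuous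
    exact hc.continuousAt.eventually (Units.isOpen.mem_nhds (by simp))
  have hsurj (g : E →L[ℝ] E) :
      ∃ s x t, J₁ s + J₂ x + LinearMap.toContinuousLinearMap (diag b) t = g := by
    have hg : g ∈ (leibnizDefect b β).ker ⊔ (diag b).range ⊔ M := by
      rw [codisjoint_iff.1 hM.codisjoint]; trivial
    rw [← hJ₁, ← hJ₂] at hg
    obtain ⟨y, hy, _, ⟨x, rfl⟩, rfl⟩ := Submodule.mem_sup.1 hg
    obtain ⟨_, ⟨s, rfl⟩, _, ⟨t, rfl⟩, rfl⟩ := Submodule.mem_sup.1 hy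
    exact ⟨s, x, t, add_right_comm (J₁ s) (J₂ x) (diag b t)⟩
  have htrans (x) (hx : J₂ x ∈ (leibnizDefect b β).ker ⊔ (diag b).range) : x = 0 :=
    hJ₂0 x (Submodule.disjoint_def.1 hM.disjoint _ hx (hJ₂ ▸ ⟨x, rfl⟩))
  filter_upwards [eventually_exists_factorization _ _ _ hsurj
    (hunit.and (h.eventually_eq_zero J₂ htrans))] with g hg b' hb' hsupp
  obtain ⟨s₀, x, t, ⟨hu, hx⟩, rfl⟩ := hg
  have hs : J₁ s₀ ∈ (leibnizDefect b β).ker := hJ₁ ▸ ⟨s₀, rfl⟩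
  generalize J₁ s₀ = s at hs hb'
  simp only [LinearMap.coe_toContinuousLinearMap'] at hb'
  have hexp := exp_apply_bilin (leibniz_of_mem_ker hs)
  have hunitexp : IsUnit (NormedSpace.exp s) := by
    let _ : NormedAlgebra ℚ (E →L[ℝ] E) := NormedAlgebra.restrictScalars ℚ ℝ _
    exact NormedSpace.isUnit_exp s
  set A := NormedSpace.exp s
  set m : E →L[ℝ] E := 1 + J₂ x with hm
  have hinvA : Ring.inverse A * A = 1 := Ring.inverse_mul_cancel _ hunitexp
  have hAinv : A * Ring.inverse A = 1 := Ring.mul_inverse_cancel _ hunitexp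
  have hinvm : Ring.inverse m * m = 1 := Ring.inverse_mul_cancel _ hu
  have hb (i : ι) : b' i = (1 + t i) • A (m (b i)) := by
    rw [hb' i]
    simp [add_smul]
  have ht (i : ι) : 1 + t i ≠ 0 := fun h0 => b'.ne_zero i (by rw [hb, h0, zero_smul])
  -- The automorphism `A` and the rescaling by `1 + t i` do not alter which structure constants
  -- vanish, so `m` alone preserves the zeros, and transversality applies.
  have hx0 : x = 0 := by
    refine hx fun i j k hk => ?_
    have e1 : β (b' i) (b' j) = ((1 + t i) * (1 + t j)) • A (β (m (b i)) (m (b j))) := by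
      rw [hb, hb, hexp]
      simp [smul_smul, mul_comm]
    have e2 : β (b' i) (b' j) =
        A (m (∑ l, (b'.coord l (β (b' i) (b' j)) * (1 + t l)) • b l)) := by
      conv_lhs => rw [← b'.sum_repr (β (b' i) (b' j))]
      rw [map_sum, map_sum]
      refine Finset.sum_congr rfl fun l _ => ?_
      rw [map_smul, map_smul, hb l, smul_smul]
      rfl
    have e3 : ((1 + t i) * (1 + t j)) • Ring.inverse m (β (m (b i)) (m (b j))) =
        ∑ l, (b'.coord l (β (b' i) (b' j)) * (1 + t l)) • b l := by
      have h1 := congrArg (fun v => Ring.inverse m (Ring.inverse A v)) (e1.symm.trans e2)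
      have k1 (v : E) : Ring.inverse A (A v) = v := DFunLike.congr_fun hinvA v
      have k2 (v : E) : Ring.inverse m (m v) = v := DFunLike.congr_fun hinvm v
      simpa only [map_smul, k1, k2] using h1
    have e4 := congrArg (b.coord k) e3
    rw [map_smul, map_sum, smul_eq_mul, Finset.sum_eq_zero] at e4
    · exact (mul_eq_zero.1 e4).resolve_left (mul_ne_zero (ht i) (ht j))
    · intro l _
      rcases eq_or_ne l k with rfl | hne
      · rw [hsupp i j l hk, zero_mul, zero_smul, map_zero]
      · simp [hne]
  refine ⟨LinearEquiv.ofLinearMap (A : E →ₗ[ℝ] E) (Ring.inverse A : E →L[ℝ] E)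
    (LinearMap.ext fun v => DFunLike.congr_fun hAinv v)
    (LinearMap.ext fun v => DFunLike.congr_fun hinvA v), hexp, fun i => ⟨(1 + t i)⁻¹, ?_⟩⟩
  have hmi : m (b i) = b i := by simp [hm, hx0]
  rw [hb, hmi, smul_smul, inv_mul_cancel₀ (ht i), one_smul]
  rfl

end Analysis

/-! ### Countability from open classes -/

/-- A setoid whose classes are neighbourhoods of their elements, in the topology induced by a map
to a second countable space, has countably many classes. -/
theorem countable_quotient_of_eventually {X Y : Type*} [TopologicalSpace Y]
    [SecondCountableTopology Y] (s : Setoid X) (f : X → Y)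
    (h : ∀ x, ∀ᶠ w in 𝓝 (f x), ∀ y, f y = w → s x y) : Countable (Quotient s) := by
  let _ : TopologicalSpace X := TopologicalSpace.induced f inferInstance
  have : SecondCountableTopology X := TopologicalSpace.secondCountableTopology_induced X Y f
  -- Open classes make the quotient discrete; it is also separable, hence countable.
  have : DiscreteTopology (Quotient s) := by
    rw [discreteTopology_iff_forall_isOpen]
    intro U
    rw [← isQuotientMap_quotient_mk'.isOpen_preimage, isOpen_iff_mem_nhds]
    intro x hx
    have h1 : ∀ᶠ y in 𝓝 x, ∀ z, f z = f y → s x z :=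
      continuous_induced_dom.continuousAt.eventually (h x)
    filter_upwards [h1] with y hy
    have : (Quotient.mk s y) = Quotient.mk s x := (Quotient.sound (hy y rfl)).symm
    change Quotient.mk s y ∈ U
    rw [this]
    exact hx
  exact TopologicalSpace.separableSpace_iff_countable.1 inferInstance

/-! ### Application to nice bases of a Lie algebra -/

section Lie

variable {L : Type*} [LieRing L] [LieAlgebra ℝ L] {ι : Type*} [Fintype ι]

/-- The bracket of a real Lie algebra in the coordinates of a basis. -/
def coordBracket (e : Basis ι ℝ L) : (ι → ℝ) →L[ℝ] (ι → ℝ) →L[ℝ] (ι → ℝ) :=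
  LinearMap.toContinuousLinearMap
    ((LinearMap.toContinuousLinearMap : ((ι → ℝ) →ₗ[ℝ] (ι → ℝ)) ≃ₗ[ℝ] _).toLinearMap ∘ₗ
      (((LieModule.toEnd ℝ L L : L →ₗ[ℝ] Module.End ℝ L).compr₂ e.equivFun.toLinearMap).compl₁₂
        e.equivFun.symm.toLinearMap e.equivFun.symm.toLinearMap))

theorem coordBracket_apply (e : Basis ι ℝ L) (u v : ι → ℝ) :
    coordBracket e u v = e.equivFun ⁅e.equivFun.symm u, e.equivFun.symm v⁆ := rfl

/-- The bracket condition gives uniqueness of the output index, the condition on `d` that of the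
second input, and skew-symmetry that of the first. -/
theorem IsNice.nicePattern {e : Basis ι ℝ L} (he : IsNice e) :
    NicePattern (Pi.basisFun ℝ ι) (coordBracket e) := by
  classical
  have hc (i j k : ι) : (Pi.basisFun ℝ ι).coord k
      (coordBracket e (Pi.basisFun ℝ ι i) (Pi.basisFun ℝ ι j)) = e.coord k ⁅e i, e j⁆ := by
    simp [coordBracket_apply]
  have hsnd {i j k l : ι} (h1 : e.coord k ⁅e i, e j⁆ ≠ 0) (h2 : e.coord k ⁅e i, e l⁆ ≠ 0) :
      j = l := by
    obtain ⟨h, c, hh⟩ := he.2 i k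
    have key (a : ι) (ha : e.coord k ⁅e i, e a⁆ ≠ 0) : a = h := by
      by_contra hne
      have := LinearMap.congr_fun hh (e a)
      rw [extDeriv_apply] at this
      simp [hne] at this
      exact ha this
    rw [key j h1, key l h2]
  refine ⟨fun {i j k l} h1 h2 => ?_, fun {i j k l} h1 h2 => ?_, fun {i j k l} h1 h2 => ?_⟩
  · rw [hc] at h1 h2
    obtain ⟨h, c, hh⟩ := he.1 i j
    have key (a : ι) (ha : e.coord a ⁅e i, e j⁆ ≠ 0) : a = h := by
      by_contra hne
      rw [hh] at ha
      simp [Ne.symm hne] at ha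
    rw [key k h1, key l h2]
  · rw [hc] at h1 h2
    refine hsnd (i := j) (k := k) ?_ ?_
    · rwa [← lie_skew, map_neg, neg_ne_zero]
    · rwa [← lie_skew, map_neg, neg_ne_zero]
  · rw [hc] at h1 h2
    exact hsnd h1 h2

/-- The coordinate vectors and the support of the structure constants of a basis. -/
def invariants (e₀ : Basis ι ℝ L) (e : Basis ι ℝ L) : (ι → ι → ℝ) × (ι → ι → ι → Bool) :=
  open Classical in
  (fun i => e₀.equivFun (e i), fun i j k => decide (e.coord k ⁅e i, e j⁆ = 0))

theorem IsNice.eventually_equivalent (e₀ : Basis ι ℝ L) {e : Basis ι ℝ L} (he : IsNice e) :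
    ∀ᶠ w in 𝓝 (invariants e₀ e), ∀ e' : Basis ι ℝ L, invariants e₀ e' = w → Equivalent e e' := by
  classical
  -- Turns the `e₀`-coordinates of a basis `e'` into the operator carrying `e` to `e'`, written in
  -- `e`-coordinates; it is the identity at `e' = e`.
  let T : (ι → ι → ℝ) →ₗ[ℝ] (ι → ℝ) →L[ℝ] (ι → ℝ) :=
    (LinearMap.toContinuousLinearMap : ((ι → ℝ) →ₗ[ℝ] (ι → ℝ)) ≃ₗ[ℝ] _).toLinearMap ∘ₗ
      ((Pi.basisFun ℝ ι).constr ℝ).toLinearMap ∘ₗ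
        LinearMap.pi fun i => (e.equivFun.toLinearMap ∘ₗ e₀.equivFun.symm.toLinearMap) ∘ₗ
          LinearMap.proj i
  have hT (e' : Basis ι ℝ L) (i : ι) :
      T (invariants e₀ e').1 (Pi.basisFun ℝ ι i) = e.equivFun (e' i) := by
    change (Pi.basisFun ℝ ι).constr ℝ _ (Pi.basisFun ℝ ι i) = _
    rw [Basis.constr_basis]
    simp [invariants]
  have hT1 : T (invariants e₀ e).1 = 1 := by
    apply ContinuousLinearMap.coe_injective
    refine (Pi.basisFun ℝ ι).ext fun i => ?_
    refine (hT e i).trans ?_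
    ext j
    simp [Pi.single_apply, eq_comm]
  have hcont : Continuous fun w : (ι → ι → ℝ) × (ι → ι → ι → Bool) => T w.1 :=
    T.continuous_of_finiteDimensional.comp continuous_fst
  have hev := he.nicePattern.eventually_exists_automorphism
  rw [← hT1] at hev
  -- The support takes values in a discrete space, so it is locally constant.
  have hsupp : ∀ᶠ w : (ι → ι → ℝ) × (ι → ι → ι → Bool) in 𝓝 (invariants e₀ e),
      w.2 = (invariants e₀ e).2 :=
    continuous_snd.continuousAt.eventually
      ((isOpen_discrete {(invariants e₀ e).2}).mem_nhds (Set.mem_singleton _))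
  filter_upwards [hcont.continuousAt.eventually hev, hsupp] with w hw hws e' he'
  subst he'
  obtain ⟨φ, hφ, hφb⟩ := hw (e'.map e.equivFun) (fun i => by rw [hT, Basis.map_apply])
    (fun i j k hk => by
      have h1 : e.coord k ⁅e i, e j⁆ = 0 := by simpa [coordBracket_apply] using hk
      have h2 := congrFun (congrFun (congrFun hws i) j) k
      have h3 : e'.coord k ⁅e' i, e' j⁆ = 0 := by
        simp only [invariants, decide_eq_decide] at h2
        exact h2.2 h1
      simpa [coordBracket_apply] using h3)
  let ψ : L ≃ₗ[ℝ] L := (e.equivFun.trans φ).trans e.equivFun.symm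
  have hψ (u v : L) : ψ ⁅u, v⁆ = ⁅ψ u, ψ v⁆ := by
    have := congrArg e.equivFun.symm (hφ (e.equivFun u) (e.equivFun v))
    simp only [coordBracket_apply, LinearEquiv.symm_apply_apply] at this
    exact this
  refine ⟨{ ψ with map_lie' := fun {u v} => hψ u v }, fun i => ?_⟩
  obtain ⟨c, hc⟩ := hφb i
  refine ⟨i, c, ?_⟩
  change e.equivFun.symm (φ (e.equivFun (e i))) = _
  have hei : e.equivFun (e i) = Pi.basisFun ℝ ι i := by
    ext j
    simp [Pi.single_apply, eq_comm]
  rw [hei, hc, Basis.map_apply, map_smul, LinearEquiv.symm_apply_apply]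

end Lie

end NiceLie

end

theorem mainTheorem2 (L : Type*) [LieRing L] [LieAlgebra ℝ L] [FiniteDimensional ℝ L]
    [LieRing.IsNilpotent L] :
    Countable (Quotient (NiceLie.niceBasisSetoid L)) := by
  refine NiceLie.countable_quotient_of_eventually _
    (fun e => NiceLie.invariants (Module.finBasis ℝ L) e.1) fun e => ?_
  filter_upwards [e.2.eventually_equivalent (Module.finBasis ℝ L)] with w hw e' he'
  exact hw e'.1 he'
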